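/- Let $K$ be an algebraically closed field of characteristic zero and let $Q$ be a Euclidean quiver without oriented cycles, i.e. the underlying graph of $Q$ is an extended Dynkin diagram $\tilde A_n$ ($n\ge 1$), $\tilde D_n$ ($n\ge 4$), $\tilde E_6$, $\tilde E_7$ or $\tilde E_8$. All representations are finite-dimensional representations of $Q$ over $K$. Let $\langle\alpha,\beta\rangle=\sum_{x\in Q_0}\alpha(x)\beta(x)-\sum_{a\in Q_1}\alpha(ta)\beta(ha)$ be the Euler form and let $\delta$ be the unique imaginary Schur root of $Q$, i.e. the dimension vector of a representation with endomorphism ring $K$ such that $\langle\delta,\delta\rangle\le 0$. A representation is called regular if all its indecomposable direct summands $U$ have defect $\langle\delta,\underline{\dim}\,U\rangle=0$. Let $V_1,\dots,V_t$ be an orthogonal Schur sequence, i.e. $\operatorname{End}_Q(V_i)\cong K$ for all $i$ and $\operatorname{Hom}_Q(V_i,V_j)=0$ for all $i\ne j$. Suppose that at least one $V_i$ is regular and at least one $V_i$ is not regular. Then there is a permutation $\sigma$ of $\{1,\dots,t\}$ such that $(V_{\sigma(1)},\dots,V_{\sigma(t)})$ is an orthogonal exceptional sequence, i.e. $\operatorname{End}_Q(V_i)\cong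 K$ and $\operatorname{Ext}^1_Q(V_i,V_i)=0$ for all $i$, $\operatorname{Hom}_Q(V_i,V_j)=0$ for all $i\neq j$, and $\operatorname{Ext}^1_Q(V_{\sigma(i)},V_{\sigma(j)})=0$ for all $i<j$. In particular, $\underline{\dim}\,V_i\ne\delta$ for all $i$. -/

import Mathlib

universe u v w

namespace QuiverRep

/-! ## Quivers -/

section Quivers

variable (Q : Type v) [Quiver.{w} Q]

/-- A quiver has no oriented cycles if the only paths from a vertex to itself are the trivial
ones. -/
def IsAcyclic : Prop :=
  ∀ (x : Q) (p : Quiver.Path x x), p = Quiver.Path.nil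

/-- The set of all arrows of the quiver, each with its tail and its head. -/
abbrev Arrow : Type (max v w) := Σ x : Q, Σ y : Q, (x ⟶ y)

/-- A finite multigraph with vertices `Fin n` and edges `Fin m` is given by the unordered pair
of ends of each edge. The quiver `Q` has this underlying graph if forgetting the orientation of
the arrows of `Q` gives a multigraph isomorphic to it. -/
def HasUnderlyingGraph {n m : ℕ} (ends : Fin m → Sym2 (Fin n)) : Prop :=
  ∃ (e : Q ≃ Fin n) (f : Arrow Q ≃ Fin m),
    ∀ (x y : Q) (a : x ⟶ y), ends (f ⟨x, y, a⟩) = s(e x, e y)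

/-- The extended Dynkin diagram of type `A` with `n + 1` vertices: a cycle with `n + 1` edges
`i — i + 1` (indices modulo `n + 1`). For `n = 1` it is a double edge. -/
def affineA (n : ℕ) : Fin (n + 1) → Sym2 (Fin (n + 1)) :=
  fun i => s(i, i + 1)

/-- The extended Dynkin diagram of type `D` with `k + 5` vertices (that is, of type `D` with
index `n = k + 4 ≥ 4`): a path `1 — 2 — ⋯ — k + 3` together with the two further edges
`0 — 2` and `k + 2 — k + 4`. -/
def affineD (k : ℕ) : Fin (k + 4) → Sym2 (Fin (k + 5)) :=
  fun j =>
    if j = 0 then s(0, 2)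
    else if j = Fin.last (k + 3) then s(⟨k + 2, by omega⟩, ⟨k + 4, by omega⟩)
    else s(j.castSucc, j.succ)

/-- The extended Dynkin diagram of type `E₆`: a star with centre `0` and three arms with
`2`, `2`, `2` edges. -/
def affineE6 : Fin 6 → Sym2 (Fin 7) :=
  ![s(0, 1), s(1, 2), s(0, 3), s(3, 4), s(0, 5), s(5, 6)]

/-- The extended Dynkin diagram of type `E₇`: a star with centre `0` and three arms with
`1`, `3`, `3` edges. -/
def affineE7 : Fin 7 → Sym2 (Fin 8) :=
  ![s(0, 1), s(0, 2), s(2, 3), s(3, 4), s(0, 5), s(5, 6), s(6, 7)]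

/-- The extended Dynkin diagram of type `E₈`: a star with centre `0` and three arms with
`1`, `2`, `5` edges. -/
def affineE8 : Fin 8 → Sym2 (Fin 9) :=
  ![s(0, 1), s(0, 2), s(2, 3), s(0, 4), s(4, 5), s(5, 6), s(6, 7), s(7, 8)]

/-- A quiver is Euclidean if its underlying graph is an extended Dynkin diagram of type
`A` (index `n ≥ 1`), `D` (index `n ≥ 4`), `E₆`, `E₇` or `E₈`. -/
def IsEuclidean : Prop :=
  (∃ n : ℕ, 1 ≤ n ∧ HasUnderlyingGraph Q (affineA n)) ∨
  (∃ k : ℕ, HasUnderlyingGraph Q (affineD k)) ∨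
  HasUnderlyingGraph Q affineE6 ∨
  HasUnderlyingGraph Q affineE7 ∨
  HasUnderlyingGraph Q affineE8

variable {Q} [Fintype Q] [∀ x y : Q, Fintype (x ⟶ y)]

/-- The Euler form `⟨α, β⟩ = ∑ₓ α(x) β(x) - ∑ₐ α(ta) β(ha)`. -/
def eulerForm (α β : Q → ℤ) : ℤ :=
  ∑ x, α x * β x - ∑ x, ∑ y, ∑ _a : x ⟶ y, α x * β y

/-- The Tits form `q(α) = ⟨α, α⟩`. -/
def titsForm (α : Q → ℤ) : ℤ :=
  eulerForm α α

end Quivers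

/-! ## Representations -/

/-- A finite-dimensional representation of the quiver `Q` over the field `K`. -/
structure Rep (K : Type u) [Field K] (Q : Type v) [Quiver.{w} Q] where
  /-- The vector space at each vertex. -/
  space : Q → Type u
  [addCommGroup : ∀ x, AddCommGroup (space x)]
  [module : ∀ x, Module K (space x)]
  [finite : ∀ x, Module.Finite K (space x)]
  /-- The linear map attached to each arrow. -/
  map : ∀ {x y : Q}, (x ⟶ y) → (space x →ₗ[K] space y)

attribute [instance] Rep.addCommGroup Rep.module Rep.finite

namespace Rep

variable {K : Type u} [Field K] {Q : Type v} [Quiver.{w} Q]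

/-- The dimension vector of a representation. -/
noncomputable def dimVec (V : Rep K Q) : Q → ℤ :=
  fun x => (Module.finrank K (V.space x) : ℤ)

/-- The space `Hom_Q(V, W)` of morphisms of representations. -/
def Hom (V W : Rep K Q) : Submodule K (∀ x, V.space x →ₗ[K] W.space x) where
  carrier := {φ | ∀ (x y : Q) (a : x ⟶ y), φ y ∘ₗ V.map a = W.map a ∘ₗ φ x}
  add_mem' := by
    intro φ ψ hφ hψ x y a
    simp only [Pi.add_apply, LinearMap.add_comp, LinearMap.comp_add, hφ x y a, hψ x y a]
  zero_mem' := by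
    intro x y a
    simp
  smul_mem' := by
    intro c φ hφ x y a
    simp only [Pi.smul_apply, LinearMap.smul_comp, LinearMap.comp_smul, hφ x y a]

/-- The endomorphism algebra `End_Q(V)`, whose multiplication is composition. -/
def End (V : Rep K Q) : Subalgebra K (∀ x, Module.End K (V.space x)) where
  carrier := {φ | ∀ (x y : Q) (a : x ⟶ y), φ y ∘ₗ V.map a = V.map a ∘ₗ φ x}
  add_mem' := by
    intro φ ψ hφ hψ x y a
    simp only [Pi.add_apply, LinearMap.add_comp, LinearMap.comp_add, hφ x y a, hψ x y a]
  mul_mem' := by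
    intro φ ψ hφ hψ x y a
    simp only [Pi.mul_apply, Module.End.mul_eq_comp]
    rw [LinearMap.comp_assoc, hψ x y a, ← LinearMap.comp_assoc, hφ x y a, LinearMap.comp_assoc]
  algebraMap_mem' := by
    intro c x y a
    ext m
    simp [Module.algebraMap_end_apply]

/-- `V` is a Schur representation if `End_Q(V)` is isomorphic to `K` as a `K`-algebra. -/
def IsSchur (V : Rep K Q) : Prop :=
  Nonempty (End V ≃ₐ[K] K)

/-- `Ext¹_Q(V, W) = 0`: every short exact sequence `0 → W → E → V → 0` of representations
splits. -/
def ExtOneVanishes (V W : Rep K Q) : Prop :=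
  ∀ (E : Rep K Q) (i : Hom W E) (p : Hom E V),
    (∀ x, Function.Injective (i.1 x)) →
    (∀ x, Function.Exact (i.1 x) (p.1 x)) →
    (∀ x, Function.Surjective (p.1 x)) →
    ∃ s : Hom V E, ∀ x, p.1 x ∘ₗ s.1 x = LinearMap.id

/-- The direct sum of two representations. -/
def directSum (V W : Rep K Q) : Rep K Q where
  space x := V.space x × W.space x
  map a := (V.map a).prodMap (W.map a)

/-- Two representations are isomorphic if there is a morphism between them that is bijective at
each vertex. -/
def IsIsomorphic (V W : Rep K Q) : Prop :=
  ∃ φ : Hom V W, ∀ x, Function.Bijective (φ.1 x)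

/-- The zero representation. -/
def IsZero (V : Rep K Q) : Prop :=
  ∀ x, Subsingleton (V.space x)

/-- `V` is indecomposable if it is nonzero and not isomorphic to a direct sum of two nonzero
representations. -/
def IsIndecomposable (V : Rep K Q) : Prop :=
  ¬ IsZero V ∧ ∀ A B : Rep K Q, IsIsomorphic V (directSum A B) → IsZero A ∨ IsZero B

/-- `U` is (isomorphic to) a direct summand of `V`. -/
def IsDirectSummand (U V : Rep K Q) : Prop :=
  ∃ W : Rep K Q, IsIsomorphic V (directSum U W)

/-- An orthogonal Schur sequence: Schur representations without nonzero morphisms between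
different members. -/
def IsOrthogonalSchurSequence {t : ℕ} (V : Fin t → Rep K Q) : Prop :=
  (∀ i, IsSchur (V i)) ∧ ∀ i j, i ≠ j → Hom (V i) (V j) = ⊥

/-- `V` is exceptional if it is Schur and `Ext¹_Q(V, V) = 0`. -/
def IsExceptional (V : Rep K Q) : Prop :=
  IsSchur V ∧ ExtOneVanishes V V

/-- An exceptional sequence: exceptional representations with
`Hom_Q(V_i, V_j) = Ext¹_Q(V_i, V_j) = 0` for `i < j`. -/
def IsExceptionalSequence {t : ℕ} (V : Fin t → Rep K Q) : Prop :=
  (∀ i, IsExceptional (V i)) ∧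
    ∀ i j, i < j → Hom (V i) (V j) = ⊥ ∧ ExtOneVanishes (V i) (V j)

/-- An orthogonal exceptional sequence: an exceptional sequence with `Hom_Q(V_i, V_j) = 0` for
all `i ≠ j`. -/
def IsOrthogonalExceptionalSequence {t : ℕ} (V : Fin t → Rep K Q) : Prop :=
  IsExceptionalSequence V ∧ ∀ i j, i ≠ j → Hom (V i) (V j) = ⊥

section Defect

variable [Fintype Q] [∀ x y : Q, Fintype (x ⟶ y)]

/-- The defect `⟨δ, dim V⟩` of a representation. -/
noncomputable def defect (δ : Q → ℤ) (V : Rep K Q) : ℤ :=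
  eulerForm δ (dimVec V)

/-- `V` is regular if all its indecomposable direct summands have defect zero. -/
def IsRegular (δ : Q → ℤ) (V : Rep K Q) : Prop :=
  ∀ U : Rep K Q, IsIndecomposable U → IsDirectSummand U V → defect δ U = 0

end Defect

end Rep

/-- `δ` is an imaginary Schur root of `Q` over `K`: it is the dimension vector of a Schur
representation, and `q(δ) ≤ 0`. An acyclic Euclidean quiver has exactly one such `δ`. -/
def IsImaginarySchurRoot (K : Type u) [Field K] {Q : Type v} [Quiver.{w} Q] [Fintype Q]
    [∀ x y : Q, Fintype (x ⟶ y)] (δ : Q → ℤ) : Prop :=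
  (∃ V : Rep K Q, V.IsSchur ∧ V.dimVec = δ) ∧ titsForm δ ≤ 0

end QuiverRep

/-! Since `⟨dim V, dim W⟩ = dim Hom - dim Ext¹`, the dimension vectors `vᵢ` of an orthogonal Schur
sequence satisfy `⟨vᵢ, vᵢ⟩ ≤ 1` and `⟨vᵢ, vⱼ⟩ ≤ 0` for `i ≠ j`. The Tits form of a Euclidean quiver
is positive semidefinite with radical a line spanned by a positive vector
(`IsEuclidean.isTitsNullRankOne`).

Let `α` be the sum of the `vᵢ` over a nonempty set `S`. If `⟨α, vᵢ⟩ ≤ 0` for all `i ∈ S`, then `α`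
is a nonzero null vector, hence proportional to `δ`, and every `vₖ` has defect zero
(`IsTitsNullRankOne.eulerForm_eq_zero`). A nonregular member excludes this, so some `i ∈ S` has `⟨α,
vᵢ⟩ > 0`. As `⟨vᵢ, vᵢ⟩ ≤ 1` and the other terms are nonpositive integers, they all vanish: `Ext¹(Vⱼ,
Vᵢ) = 0` for the other `j ∈ S`, and `Vᵢ` may be put last. Recursion on `S` gives the order;
singletons give `⟨vᵢ, vᵢ⟩ = 1`, so each `Vᵢ` is exceptional. -/

namespace QuiverRep

/-! ## The Euler form -/

section EulerForm

variable {Q : Type v} [Quiver.{w} Q] [Fintype Q] [∀ x y : Q, Fintype (x ⟶ y)]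

/-- The Euler form as a bilinear map. -/
def eulerBilin : (Q → ℤ) →ₗ[ℤ] (Q → ℤ) →ₗ[ℤ] ℤ :=
  LinearMap.mk₂ ℤ eulerForm
    (by
      intro a b c
      simp only [eulerForm, Pi.add_apply, add_mul, Finset.sum_add_distrib]
      ring)
    (by
      intro r a b
      simp only [eulerForm, Pi.smul_apply, smul_eq_mul, mul_assoc, ← Finset.mul_sum, mul_sub])
    (by
      intro a b c
      simp only [eulerForm, Pi.add_apply, mul_add, Finset.sum_add_distrib]
      ring)
    (by
      intro r a b
      simp only [eulerForm, Pi.smul_apply, smul_eq_mul, mul_left_comm _ r, ← Finset.mul_sum,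
        mul_sub])

lemma eulerBilin_apply (a b : Q → ℤ) : eulerBilin a b = eulerForm a b := rfl

/-- The Tits form is positive semidefinite, and its null vectors are proportional to a single
positive vector. -/
def IsTitsNullRankOne (Q : Type v) [Quiver.{w} Q] [Fintype Q] [∀ x y : Q, Fintype (x ⟶ y)] :
    Prop :=
  (∀ a : Q → ℤ, 0 ≤ titsForm a) ∧
    ∃ d : Q → ℤ, (∀ x, 0 < d x) ∧
      ∀ a : Q → ℤ, titsForm a = 0 → ∀ x y, a x * d y = a y * d x

/-- A semidefinite form restricted to the line `N a + b` through a null direction is affine in `N`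
and bounded below, so its slope vanishes. -/
lemma IsTitsNullRankOne.polar_eq_zero (h : IsTitsNullRankOne Q) {a : Q → ℤ}
    (ha : titsForm a = 0) (b : Q → ℤ) : eulerForm a b + eulerForm b a = 0 := by
  have key : ∀ N : ℤ, 0 ≤ N * (eulerForm a b + eulerForm b a) + titsForm b := by
    intro N
    have h1 := h.1 (N • a + b)
    have h2 : titsForm (N • a + b) =
        N * N * titsForm a + N * (eulerForm a b + eulerForm b a) + titsForm b := by
      simp only [titsForm, ← eulerBilin_apply, map_add, map_smul, LinearMap.add_apply,
        LinearMap.smul_apply, smul_eq_mul]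
      ring
    rw [h2, ha] at h1
    linarith
  have hb := h.1 b
  set B := eulerForm a b + eulerForm b a
  -- These two values of `N` suffice: a slope `B` with `|B| ≥ 1` would make one of the two values
  -- negative.
  have h1 := key (titsForm b + 1)
  have h2 := key (-(titsForm b + 1))
  rcases lt_trichotomy B 0 with hB | hB | hB
  · nlinarith
  · exact hB
  · nlinarith

/-- Null vectors are proportional; cross-multiplying keeps this over `ℤ`. It transfers vanishing
from the partial sum `α` to `δ`. -/
lemma IsTitsNullRankOne.mul_eulerForm (h : IsTitsNullRankOne Q) {a b : Q → ℤ}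
    (ha : titsForm a = 0) (hb : titsForm b = 0) (x : Q) (c : Q → ℤ) :
    b x * eulerForm a c = a x * eulerForm b c := by
  obtain ⟨-, d, hd, hnull⟩ := h
  have hab : b x • a = a x • b := by
    funext y
    have h1 := hnull a ha y x
    have h2 := hnull b hb y x
    have : d x * (b x * a y) = d x * (a x * b y) := by
      linear_combination b x * h1 - a x * h2
    exact mul_left_cancel₀ (hd x).ne' this
  have := congrArg (fun f => eulerBilin f c) hab
  simpa only [map_smul, LinearMap.smul_apply, smul_eq_mul, eulerBilin_apply] using this

/-- In a family of nonnegative vectors with nonpositive mutual Euler pairings, a partial sum `s`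
with `⟨s, v i⟩ ≤ 0` for all its members `v i` is a null vector of the Tits form, and all members
of the family have defect zero. -/
lemma IsTitsNullRankOne.eulerForm_eq_zero (h : IsTitsNullRankOne Q) {ι : Type*}
    {v : ι → Q → ℤ} (hnonneg : ∀ i x, 0 ≤ v i x) (hne : ∀ i, v i ≠ 0)
    (hle : ∀ i j, i ≠ j → eulerForm (v i) (v j) ≤ 0) {S : Finset ι} (hS : S.Nonempty)
    (hsum : ∀ i ∈ S, eulerForm (∑ j ∈ S, v j) (v i) ≤ 0)
    {δ : Q → ℤ} (hδ : titsForm δ ≤ 0) (k : ι) : eulerForm δ (v k) = 0 := by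
  set α := ∑ j ∈ S, v j with hα
  have htits : titsForm α = ∑ i ∈ S, eulerForm α (v i) := by
    simp only [titsForm, ← eulerBilin_apply]
    conv_lhs => rw [hα, map_sum]
  have hα0 : titsForm α = 0 :=
    le_antisymm (htits ▸ Finset.sum_nonpos hsum) (h.1 α)
  have hδ0 : titsForm δ = 0 := le_antisymm hδ (h.1 δ)
  obtain ⟨x, hx⟩ : ∃ x, α x ≠ 0 := by
    obtain ⟨i, hi⟩ := hS
    obtain ⟨x, hx⟩ := Function.ne_iff.1 (hne i)
    refine ⟨x, ne_of_gt ?_⟩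
    rw [hα, Finset.sum_apply]
    exact Finset.sum_pos' (fun j _ => hnonneg j x) ⟨i, hi, lt_of_le_of_ne (hnonneg i x) (Ne.symm hx)⟩
  have hαk : eulerForm α (v k) = 0 := by
    by_cases hk : k ∈ S
    · rw [htits] at hα0
      exact (Finset.sum_eq_zero_iff_of_nonpos hsum).1 hα0 k hk
    -- Outside `S` both pairings with `α` are nonpositive, and they add up to zero because `α` is
    -- null.
    · have h1 : eulerForm α (v k) ≤ 0 := by
        rw [hα, ← eulerBilin_apply, map_sum, LinearMap.sum_apply]
        exact Finset.sum_nonpos fun j hj => hle j k (fun e => hk (e ▸ hj))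
      have h2 : eulerForm (v k) α ≤ 0 := by
        rw [hα, ← eulerBilin_apply, map_sum]
        exact Finset.sum_nonpos fun j hj => hle k j (fun e => hk (e ▸ hj))
      have h3 := h.polar_eq_zero hα0 (v k)
      linarith
  have := h.mul_eulerForm hα0 hδ0 x (v k)
  rw [hαk, mul_zero] at this
  exact (mul_eq_zero.1 this.symm).resolve_left hx

end EulerForm

/-! ## Extended Dynkin diagrams -/

section Graphs

variable {n m : ℕ}

/-- The quadratic form of a multigraph. -/
def graphForm (ends : Fin m → Sym2 (Fin n)) (a : Fin n → ℤ) : ℤ :=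
  ∑ i, a i * a i - ∑ e, ((ends e).map a).mul

lemma titsForm_eq_graphForm {Q : Type v} [Quiver.{w} Q] [Fintype Q]
    [∀ x y : Q, Fintype (x ⟶ y)] {ends : Fin m → Sym2 (Fin n)} (e : Q ≃ Fin n)
    (f : Arrow Q ≃ Fin m)
    (hf : ∀ (x y : Q) (a : x ⟶ y), ends (f ⟨x, y, a⟩) = s(e x, e y)) (a : Q → ℤ) :
    titsForm a = graphForm ends (a ∘ e.symm) := by
  have h1 : ∑ i, (a ∘ e.symm) i * (a ∘ e.symm) i = ∑ x, a x * a x :=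
    Equiv.sum_comp e.symm (fun x => a x * a x)
  have h2 : ∑ j, ((ends j).map (a ∘ e.symm)).mul = ∑ x, ∑ y, ∑ _b : x ⟶ y, a x * a y := by
    rw [← Equiv.sum_comp f, Fintype.sum_sigma]
    refine Finset.sum_congr rfl fun x _ => ?_
    rw [Fintype.sum_sigma]
    refine Finset.sum_congr rfl fun y _ => Finset.sum_congr rfl fun b _ => ?_
    rw [hf, Sym2.map_mk, Sym2.mul_mk]
    simp
  rw [titsForm, eulerForm, graphForm, h1, h2]

/-- A positive radical vector `d` (`hrad`) turns twice the form into the sum of squares `∑ₑ d_p d_r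
(a_p / d_p - a_r / d_r)²`. A null vector therefore has `a / d` constant along edges, hence constant
by connectedness, which is what `hconn` encodes. -/
lemma HasUnderlyingGraph.isTitsNullRankOne {Q : Type v} [Quiver.{w} Q] [Fintype Q]
    [∀ x y : Q, Fintype (x ⟶ y)] {ends : Fin m → Sym2 (Fin n)} (h : HasUnderlyingGraph Q ends)
    (p r : Fin m → Fin n) (hends : ∀ e, ends e = s(p e, r e)) (d : Fin n → ℤ)
    (hd : ∀ i, 0 < d i)
    (hrad : ∀ i, ∑ e, ((if p e = i then d (r e) else 0) + (if r e = i then d (p e) else 0)) =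
      2 * d i)
    (hconn : ∀ g : Fin n → ℚ, (∀ e, g (p e) = g (r e)) → ∀ i j, g i = g j) :
    IsTitsNullRankOne Q := by
  obtain ⟨e, f, hf⟩ := h
  have hd' : ∀ i, (d i : ℚ) ≠ 0 := fun i => by exact_mod_cast (hd i).ne'
  have hq : ∀ a : Fin n → ℤ, (2 * graphForm ends a : ℚ) =
      ∑ e, (d (p e) * d (r e) : ℚ) * (a (p e) / d (p e) - a (r e) / d (r e)) ^ 2 := by
    intro a
    have h1 : ∀ e, (d (p e) * d (r e) : ℚ) * (a (p e) / d (p e) - a (r e) / d (r e)) ^ 2 =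
        (∑ i, ((if p e = i then (d (r e) : ℚ) else 0) + (if r e = i then (d (p e) : ℚ) else 0)) *
          ((a i : ℚ) ^ 2 / d i)) - 2 * (a (p e) * a (r e)) := by
      intro e
      have := hd' (p e)
      have := hd' (r e)
      simp only [add_mul, ite_mul, zero_mul, Finset.sum_add_distrib, Finset.sum_ite_eq,
        Finset.mem_univ, if_true]
      field_simp
      ring
    have h2 : ∀ i, (∑ e, ((if p e = i then (d (r e) : ℚ) else 0) +
        (if r e = i then (d (p e) : ℚ) else 0))) = 2 * d i := by
      intro i
      exact_mod_cast hrad i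
    simp only [h1, Finset.sum_sub_distrib]
    -- Summing over edges first, the coefficient of `aᵢ² / dᵢ` becomes `2 dᵢ` by `hrad`.
    rw [Finset.sum_comm]
    simp only [← Finset.sum_mul, h2, ← Finset.mul_sum]
    simp only [graphForm, hends, Sym2.map_mk, Sym2.mul_mk]
    push_cast
    rw [mul_sub, Finset.mul_sum]
    congr 1
    refine Finset.sum_congr rfl fun i _ => ?_
    have := hd' i
    field_simp
  have hterm : ∀ (a : Fin n → ℤ) (j : Fin m),
      0 ≤ (d (p j) * d (r j) : ℚ) * (a (p j) / d (p j) - a (r j) / d (r j)) ^ 2 := by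
    intro a j
    have h1 : (0 : ℚ) < d (p j) := by exact_mod_cast hd _
    have h2 : (0 : ℚ) < d (r j) := by exact_mod_cast hd _
    positivity
  refine ⟨fun a => ?_, d ∘ e, fun x => hd _, fun a ha x y => ?_⟩
  · rw [titsForm_eq_graphForm e f hf]
    have h1 : (0 : ℚ) ≤ 2 * graphForm ends (a ∘ e.symm) := by
      rw [hq]
      exact Finset.sum_nonneg fun j _ => hterm _ j
    have h2 : (0 : ℤ) ≤ 2 * graphForm ends (a ∘ e.symm) := by exact_mod_cast h1
    linarith
  · rw [titsForm_eq_graphForm e f hf] at ha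
    have h0 := hq (a ∘ e.symm)
    rw [ha, Int.cast_zero, mul_zero] at h0
    have h1 := (Finset.sum_eq_zero_iff_of_nonneg fun j _ => hterm (a ∘ e.symm) j).1 h0.symm
    have h2 := hconn (fun i => (a ∘ e.symm) i / d i) (fun j => by
      have h3 := h1 j (Finset.mem_univ j)
      have h4 : (d (p j) * d (r j) : ℚ) ≠ 0 := mul_ne_zero (hd' _) (hd' _)
      have h5 := (mul_eq_zero.1 h3).resolve_left h4
      exact sub_eq_zero.1 (pow_eq_zero_iff two_ne_zero |>.1 h5)) (e x) (e y)
    have := hd' (e x)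
    have := hd' (e y)
    simp only [Function.comp_apply, Equiv.symm_apply_apply] at h2 ⊢
    field_simp at h2
    have h3 : (a x * d (e y) : ℚ) = a y * d (e x) := by linarith
    exact_mod_cast h3

variable {Q : Type v} [Quiver.{w} Q] [Fintype Q] [∀ x y : Q, Fintype (x ⟶ y)]

lemma isTitsNullRankOne_affineA (h : HasUnderlyingGraph Q (affineA n)) :
    IsTitsNullRankOne Q := by
  refine h.isTitsNullRankOne (fun i => i) (fun i => i + 1) (fun _ => rfl) (fun _ => 1)
    (fun _ => one_pos) (fun i => ?_) (fun g hg i j => ?_)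
  · simp [Finset.sum_add_distrib, ← eq_sub_iff_add_eq]
  · have key : ∀ i : Fin (n + 1), g i = g 0 := by
      intro i
      induction i using Fin.induction with
      | zero => rfl
      | succ i ih =>
        have := hg i.castSucc
        rw [Fin.coeSucc_eq_succ] at this
        rw [← this, ih]
    rw [key i, key j]

lemma sum_fin_ite_add_eq (N c i : ℕ) (F : ℕ → ℤ) :
    (∑ j : Fin N, if j.1 + c = i then F j.1 else 0) =
      if c ≤ i ∧ i < N + c then F (i - c) else 0 := by
  rw [Fin.sum_univ_eq_sum_range (fun j => if j + c = i then F j else 0)]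
  split_ifs with h
  · rw [Finset.sum_eq_single (i - c)]
    · rw [if_pos (by omega)]
    · intro b _ hb
      rw [if_neg (by omega)]
    · intro hi
      rw [Finset.mem_range] at hi
      omega
  · refine Finset.sum_eq_zero fun b hb => ?_
    rw [Finset.mem_range] at hb
    rw [if_neg (by omega)]

lemma isTitsNullRankOne_affineD {k : ℕ} (h : HasUnderlyingGraph Q (affineD k)) :
    IsTitsNullRankOne Q := by
  -- The null vector: `1` at the four leaves `0`, `1`, `k + 3`, `k + 4`, and `2` in between.
  set D : ℕ → ℤ := fun i => if i ≤ 1 ∨ k + 3 ≤ i then 1 else 2 with hD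
  refine h.isTitsNullRankOne
    (fun j => if j = 0 then 0 else if j = Fin.last (k + 3) then ⟨k + 2, by omega⟩ else j.castSucc)
    (fun j => if j = 0 then 2 else if j = Fin.last (k + 3) then ⟨k + 4, by omega⟩ else j.succ)
    (fun j => ?_) (fun i => D i) (fun i => ?_) (fun i => ?_) (fun g hg i j => ?_)
  · simp only [affineD]
    split_ifs <;> rfl
  · simp only [hD]
    split_ifs <;> norm_num
  · rw [Fin.sum_univ_succ, Fin.sum_univ_castSucc]
    have hne : ∀ j : Fin (k + 2), j.castSucc.succ ≠ Fin.last (k + 3) := fun j hj => by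
      have := congrArg Fin.val hj
      simp at this
      omega
    have hlast : (Fin.last (k + 2)).succ = Fin.last (k + 3) := rfl
    have hlast0 : Fin.last (k + 3) ≠ 0 := by simp [Fin.ext_iff]
    have h2 : ((2 : Fin (k + 5)) : ℕ) = 2 := rfl
    simp only [Fin.succ_ne_zero, hne, hlast, hlast0, if_true, if_false]
    simp only [Fin.ext_iff, Fin.val_zero, h2, Fin.val_castSucc, Fin.val_succ,
      Finset.sum_add_distrib]
    have e1 := sum_fin_ite_add_eq (k + 2) 1 i (fun j => D (j + 1 + 1))
    have e2 := sum_fin_ite_add_eq (k + 2) 2 i (fun j => D (j + 1))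
    simp only [add_assoc, Nat.reduceAdd] at e1 e2 ⊢
    rw [e1, e2]
    obtain ⟨i, hi⟩ := i
    have hD1 : D 0 = 1 := by simp [hD]
    have hD2 : D 2 = 2 := by simp [hD]
    have hD3 : D (k + 4) = 1 := by simp [hD]
    have hD4 : D (k + 2) = 2 := by simp [hD]
    -- Contribution of the edges whose second end is `i`; there are none at `0` and `1`. Next, `hR`
    -- treats first ends.
    have hL : (if 2 = i then D 0 else 0) + (if k + 4 = i then D (k + 2) else 0) +
        (if 2 ≤ i ∧ i < k + 4 then D (i - 2 + 1) else 0) = if i ≤ 1 then 0 else 2 := by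
      rw [hD1, hD4]
      simp only [hD]
      split_ifs <;> omega
    have hR : (if 0 = i then D 2 else 0) + (if k + 2 = i then D (k + 4) else 0) +
        (if 1 ≤ i ∧ i < k + 3 then D (i - 1 + 2) else 0) = if k + 3 ≤ i then 0 else 2 := by
      rw [hD2, hD3]
      simp only [hD]
      split_ifs <;> omega
    have hDi : (if i ≤ 1 then 0 else 2) + (if k + 3 ≤ i then 0 else 2) = 2 * D i := by
      simp only [hD]
      split_ifs <;> omega
    dsimp only
    linarith
  · have hsucc : ∀ j : ℕ, ∀ hj : j < k + 2, g ⟨j + 1, by omega⟩ = g ⟨j + 2, by omega⟩ := by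
      intro j hj
      have := hg ⟨j + 1, by omega⟩
      simpa [Fin.ext_iff, show j ≠ k + 2 by omega] using this
    have hmid : ∀ j : ℕ, ∀ hj : j < k + 3, g ⟨j + 1, by omega⟩ = g ⟨1, by omega⟩ := by
      intro j
      induction j with
      | zero => intro _; rfl
      | succ j ih =>
        intro hj
        rw [← ih (by omega), hsucc j (by omega)]
    have hfirst : g 0 = g ⟨1, by omega⟩ := by
      have := hg 0
      simp only [if_true] at this
      rw [this]
      exact hmid 1 (by omega)
    have hend : g ⟨k + 4, by omega⟩ = g ⟨1, by omega⟩ := by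
      have := hg (Fin.last (k + 3))
      have h0 : Fin.last (k + 3) ≠ 0 := by simp [Fin.ext_iff]
      simp only [h0, if_true, if_false] at this
      rw [← this]
      exact hmid (k + 1) (by omega)
    have key : ∀ i : Fin (k + 5), g i = g ⟨1, by omega⟩ := by
      rintro ⟨i, hi⟩
      rcases i with _ | i
      · exact hfirst
      · by_cases hik : i = k + 3
        · subst hik
          exact hend
        · exact hmid i (by omega)
    rw [key i, key j]

/-- On each arm of a star the null vector decreases linearly from the centre, reaching `0` one step
beyond the leaf. The same rule gives the vectors for `E₇` and `E₈`. -/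
lemma isTitsNullRankOne_affineE6 (h : HasUnderlyingGraph Q affineE6) :
    IsTitsNullRankOne Q := by
  refine h.isTitsNullRankOne ![0, 1, 0, 3, 0, 5] ![1, 2, 3, 4, 5, 6] (by decide)
    ![3, 2, 1, 2, 1, 2, 1] (by decide) (by decide) (fun g hg => ?_)
  simp [Fin.forall_fin_succ] at hg ⊢
  grind

lemma isTitsNullRankOne_affineE7 (h : HasUnderlyingGraph Q affineE7) :
    IsTitsNullRankOne Q := by
  refine h.isTitsNullRankOne ![0, 0, 2, 3, 0, 5, 6] ![1, 2, 3, 4, 5, 6, 7] (by decide)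
    ![4, 2, 3, 2, 1, 3, 2, 1] (by decide) (by decide) (fun g hg => ?_)
  simp [Fin.forall_fin_succ] at hg ⊢
  grind

lemma isTitsNullRankOne_affineE8 (h : HasUnderlyingGraph Q affineE8) :
    IsTitsNullRankOne Q := by
  refine h.isTitsNullRankOne ![0, 0, 2, 0, 4, 5, 6, 7] ![1, 2, 3, 4, 5, 6, 7, 8] (by decide)
    ![6, 3, 4, 2, 5, 4, 3, 2, 1] (by decide) (by decide) (fun g hg => ?_)
  simp [Fin.forall_fin_succ] at hg ⊢
  grind

lemma IsEuclidean.isTitsNullRankOne (h : IsEuclidean Q) : IsTitsNullRankOne Q := by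
  rcases h with ⟨n, -, h⟩ | ⟨k, h⟩ | h | h | h
  · exact isTitsNullRankOne_affineA h
  · exact isTitsNullRankOne_affineD h
  · exact isTitsNullRankOne_affineE6 h
  · exact isTitsNullRankOne_affineE7 h
  · exact isTitsNullRankOne_affineE8 h

end Graphs

/-! ## Homomorphisms and extensions -/

namespace Rep

variable {K : Type u} [Field K] {Q : Type v} [Quiver.{w} Q]

/-- The linear map whose kernel is `Hom_Q(V, W)` and whose cokernel is `Ext¹_Q(V, W)`. -/
def homDiff (V W : Rep K Q) :
    (∀ x, V.space x →ₗ[K] W.space x) →ₗ[K]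
      (∀ a : Arrow Q, V.space a.1 →ₗ[K] W.space a.2.1) where
  toFun φ a := φ a.2.1 ∘ₗ V.map a.2.2 - W.map a.2.2 ∘ₗ φ a.1
  map_add' φ ψ := by
    funext a
    simp only [Pi.add_apply, LinearMap.add_comp, LinearMap.comp_add]
    abel
  map_smul' c φ := by
    funext a
    simp only [Pi.smul_apply, LinearMap.smul_comp, LinearMap.comp_smul, smul_sub,
      RingHom.id_apply]

lemma ker_homDiff (V W : Rep K Q) : LinearMap.ker (homDiff V W) = Hom V W := by
  ext φ
  rw [LinearMap.mem_ker]
  constructor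
  · intro h x y a
    exact sub_eq_zero.1 (congrFun h ⟨x, y, a⟩)
  · intro h
    funext a
    exact sub_eq_zero.2 (h a.1 a.2.1 a.2.2)

/-- Over a field the sequence splits vertexwise. The failure of the section `s` to commute with the
arrows lies in the image of `i`; writing it as `homDiff φ` makes `s + i φ` a morphism. -/
lemma extOneVanishes_of_surjective {V W : Rep K Q}
    (h : Function.Surjective (homDiff V W)) : ExtOneVanishes V W := by
  intro E i p hi hip hp
  choose s hs using fun x => LinearMap.exists_rightInverse_of_surjective (p.1 x)
    (LinearMap.range_eq_top.2 (hp x))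
  choose l hl using fun x => LinearMap.exists_leftInverse_of_injective (i.1 x)
    (LinearMap.ker_eq_bot.2 (hi x))
  have hil : ∀ x z, p.1 x z = 0 → i.1 x (l x z) = z := by
    intro x z hz
    obtain ⟨w, rfl⟩ := (hip x z).1 hz
    rw [show l x (i.1 x w) = w from LinearMap.congr_fun (hl x) w]
  have hs' : ∀ x z, p.1 x (s x z) = z := fun x z => LinearMap.congr_fun (hs x) z
  have hpi : ∀ x w, p.1 x (i.1 x w) = 0 := fun x w => (hip x _).2 ⟨w, rfl⟩
  have hpm : ∀ {x y : Q} (a : x ⟶ y) z, p.1 y (E.map a z) = V.map a (p.1 x z) :=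
    fun {x y} a z => LinearMap.congr_fun (p.2 x y a) z
  have him : ∀ {x y : Q} (a : x ⟶ y) z, i.1 y (W.map a z) = E.map a (i.1 x z) :=
    fun {x y} a z => LinearMap.congr_fun (i.2 x y a) z
  obtain ⟨φ, hφ⟩ := h fun a => l a.2.1 ∘ₗ (E.map a.2.2 ∘ₗ s a.1 - s a.2.1 ∘ₗ V.map a.2.2)
  refine ⟨⟨fun x => s x + i.1 x ∘ₗ φ x, ?_⟩, ?_⟩
  · intro x y a
    ext z
    have h1 := LinearMap.congr_fun (congrFun hφ ⟨x, y, a⟩) z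
    simp only [homDiff, LinearMap.coe_mk, AddHom.coe_mk, LinearMap.sub_apply,
      LinearMap.comp_apply] at h1
    have h2 := hil y (E.map a (s x z) - s y (V.map a z)) (by
      rw [map_sub, hpm, hs', hs', sub_self])
    rw [← h1, map_sub, him] at h2
    simp only [LinearMap.comp_apply, LinearMap.add_apply, map_add]
    rw [← sub_eq_zero] at h2 ⊢
    rw [← h2]
    abel
  · intro x
    ext z
    simp [hs', hpi]

section Finite

variable [Fintype Q] [∀ x y : Q, Fintype (x ⟶ y)]

lemma eulerForm_eq_finrank_sub (V W : Rep K Q) :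
    eulerForm V.dimVec W.dimVec =
      (Module.finrank K (∀ x, V.space x →ₗ[K] W.space x) : ℤ) -
        Module.finrank K (∀ a : Arrow Q, V.space a.1 →ₗ[K] W.space a.2.1) := by
  simp only [Module.finrank_pi_fintype, Module.finrank_linearMap, eulerForm, dimVec]
  push_cast
  rw [Fintype.sum_sigma]
  congr 1
  refine Finset.sum_congr rfl fun x _ => ?_
  rw [Fintype.sum_sigma]

lemma eulerForm_le_finrank_hom (V W : Rep K Q) :
    eulerForm V.dimVec W.dimVec ≤ Module.finrank K (Hom V W) := by
  have h1 := LinearMap.finrank_range_add_finrank_ker (homDiff V W)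
  have h2 := Submodule.finrank_le (LinearMap.range (homDiff V W))
  rw [ker_homDiff] at h1
  rw [eulerForm_eq_finrank_sub]
  omega

/-- By rank-nullity the cokernel of `homDiff` has dimension `dim Hom - ⟨dim V, dim W⟩`, which the
hypothesis forces to be zero. -/
lemma extOneVanishes_of_finrank_hom_le {V W : Rep K Q}
    (h : (Module.finrank K (Hom V W) : ℤ) ≤ eulerForm V.dimVec W.dimVec) :
    ExtOneVanishes V W := by
  apply extOneVanishes_of_surjective
  rw [← LinearMap.range_eq_top]
  apply Submodule.eq_top_of_finrank_eq
  have h1 := LinearMap.finrank_range_add_finrank_ker (homDiff V W)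
  have h2 := Submodule.finrank_le (LinearMap.range (homDiff V W))
  rw [ker_homDiff] at h1
  rw [eulerForm_eq_finrank_sub] at h
  omega

end Finite

/-! ## Schur representations -/

lemma IsSchur.finrank_hom {V : Rep K Q} (h : V.IsSchur) : Module.finrank K (Hom V V) = 1 := by
  obtain ⟨e⟩ := h
  have h1 : Module.finrank K (End V) = 1 := by
    rw [e.toLinearEquiv.finrank_eq, Module.finrank_self]
  -- `End V` and `Hom V V` are cut out by the same equations.
  exact h1

lemma IsSchur.eq_zero_or_one_of_idempotent {V : Rep K Q} (h : V.IsSchur) (f : End V)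
    (hf : f * f = f) : f = 0 ∨ f = 1 := by
  obtain ⟨e⟩ := h
  have h1 : IsIdempotentElem (e f) := by
    rw [IsIdempotentElem, ← map_mul, hf]
  rcases IsIdempotentElem.iff_eq_zero_or_one.1 h1 with h2 | h2
  · exact Or.inl (e.injective (by rw [h2, map_zero]))
  · exact Or.inr (e.injective (by rw [h2, map_one]))

lemma IsSchur.dimVec_ne_zero {V : Rep K Q} (h : V.IsSchur) : V.dimVec ≠ 0 := by
  intro h0
  have hsub : ∀ x, Subsingleton (V.space x) := fun x => by
    have := congrFun h0 x
    simp only [dimVec, Pi.zero_apply, Nat.cast_eq_zero] at this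
    exact Module.finrank_zero_iff.1 this
  obtain ⟨e⟩ := h
  have : (1 : End V) = 0 := by
    ext x z
    exact Subsingleton.elim _ _
  exact one_ne_zero (by rw [← map_one e, this, map_zero] : (1 : K) = 0)

/-- Projection onto `A` is an idempotent endomorphism, hence `0` or `1`. -/
lemma IsSchur.isZero_or_isZero {V A B : Rep K Q} (h : V.IsSchur)
    (hV : IsIsomorphic V (directSum A B)) : IsZero A ∨ IsZero B := by
  obtain ⟨φ, hφ⟩ := hV
  let ψ : ∀ x, V.space x ≃ₗ[K] A.space x × B.space x :=
    fun x => LinearEquiv.ofBijective (φ.1 x) (hφ x)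
  have hψ : ∀ {x y : Q} (a : x ⟶ y) (z : V.space x),
      ψ y (V.map a z) = (A.map a (ψ x z).1, B.map a (ψ x z).2) :=
    fun {x y} a z => LinearMap.congr_fun (φ.2 x y a) z
  let f : End V := ⟨fun x => (ψ x).symm.toLinearMap ∘ₗ
    (LinearMap.inl K _ _ ∘ₗ LinearMap.fst K _ _) ∘ₗ (ψ x).toLinearMap, by
      intro x y a
      ext z
      apply (ψ y).injective
      simp [hψ]⟩
  have hf : ∀ x z, f.1 x z = (ψ x).symm ((ψ x z).1, 0) := fun x z => rfl
  have hff : f * f = f := by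
    ext x z
    apply (ψ x).injective
    change ψ x (f.1 x (f.1 x z)) = ψ x (f.1 x z)
    simp [hf]
  rcases h.eq_zero_or_one_of_idempotent f hff with h1 | h1
  · left
    intro x
    refine subsingleton_of_forall_eq 0 fun b => ?_
    have h2 := hf x ((ψ x).symm (b, 0))
    rw [h1] at h2
    have h3 := congrArg (ψ x) h2
    exact (congrArg Prod.fst (by simpa using h3 : (0 : A.space x × B.space x) = (b, 0))).symm
  · right
    intro x
    refine subsingleton_of_forall_eq 0 fun b => ?_
    have h2 := hf x ((ψ x).symm (0, b))
    rw [h1] at h2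
    have h3 := congrArg (ψ x) h2
    simpa [eq_comm] using h3

/-- Any indecomposable summand has zero complement, so it has the dimension vector of `V`. -/
lemma IsSchur.isRegular_of_defect_eq_zero [Fintype Q] [∀ x y : Q, Fintype (x ⟶ y)]
    {V : Rep K Q} (h : V.IsSchur) {δ : Q → ℤ} (hV : defect δ V = 0) : V.IsRegular δ := by
  rintro U hU ⟨W, hW⟩
  have hWz : IsZero W := (h.isZero_or_isZero hW).resolve_left hU.1
  obtain ⟨φ, hφ⟩ := hW
  have hdim : V.dimVec = U.dimVec := by
    funext x
    have := hWz x
    have h1 : Module.finrank K (V.space x) = Module.finrank K (U.space x × W.space x) :=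
      (LinearEquiv.ofBijective (φ.1 x) (hφ x)).finrank_eq
    rw [Module.finrank_prod, Module.finrank_zero_of_subsingleton (M := W.space x), add_zero] at h1
    simp only [dimVec, h1]
  rw [defect, ← hdim]
  exact hV

end Rep

/-! ## Ordering the sequence -/

/-- If every nonempty finite set has an element that may be put last, then there is an
enumeration compatible with the given relation. -/
lemma exists_perm_of_forall_exists_last {t : ℕ} (R : Fin t → Fin t → Prop)
    (h : ∀ S : Finset (Fin t), S.Nonempty → ∃ i ∈ S, ∀ j ∈ S, j ≠ i → R j i) :
    ∃ σ : Equiv.Perm (Fin t), ∀ i j, i < j → R (σ i) (σ j) := by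
  have key : ∀ S : Finset (Fin t), ∃ l : List (Fin t), l.Nodup ∧ (∀ i, i ∈ l ↔ i ∈ S) ∧
      l.Pairwise R := by
    intro S
    induction S using Finset.strongInduction with
    | H S ih =>
      rcases S.eq_empty_or_nonempty with rfl | hS
      · exact ⟨[], by simp⟩
      · obtain ⟨i, hi, hR⟩ := h S hS
        obtain ⟨l, hl, hmem, hp⟩ := ih (S.erase i) (Finset.erase_ssubset hi)
        refine ⟨l ++ [i], ?_, fun j => ?_, ?_⟩
        · rw [List.nodup_append]
          refine ⟨hl, List.nodup_singleton i, fun a ha b hb => ?_⟩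
          rw [List.mem_singleton] at hb
          rw [hb]
          exact (Finset.mem_erase.1 ((hmem a).1 ha)).1
        · rw [List.mem_append, hmem, List.mem_singleton, Finset.mem_erase]
          by_cases hji : j = i
          · simp [hji, hi]
          · simp [hji]
        · rw [List.pairwise_append]
          refine ⟨hp, List.pairwise_singleton R i, fun a ha b hb => ?_⟩
          rw [List.mem_singleton] at hb
          rw [hb]
          obtain ⟨h1, h2⟩ := Finset.mem_erase.1 ((hmem a).1 ha)
          exact hR a h2 h1
  obtain ⟨l, hl, hmem, hp⟩ := key Finset.univ
  let e := hl.getEquivOfForallMemList l (fun i => (hmem i).2 (Finset.mem_univ i))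
  have hlen : t = l.length := by
    simpa using (Fintype.card_congr e).symm
  refine ⟨(finCongr hlen).trans e, fun i j hij => ?_⟩
  exact List.pairwise_iff_get.1 hp (Fin.cast hlen i) (Fin.cast hlen j) hij

end QuiverRep

/-! ### Ordering an orthogonal Schur sequence -/

theorem proposition3p11 {K : Type u} [Field K] [IsAlgClosed K] [CharZero K]
    {Q : Type v} [Quiver.{w} Q] [Fintype Q] [∀ x y : Q, Fintype (x ⟶ y)]
    (hacyclic : QuiverRep.IsAcyclic Q) (heuclidean : QuiverRep.IsEuclidean Q)
    (δ : Q → ℤ) (hδ : QuiverRep.IsImaginarySchurRoot K δ)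
    {t : ℕ} (V : Fin t → QuiverRep.Rep K Q)
    (hV : QuiverRep.Rep.IsOrthogonalSchurSequence V)
    (hreg : ∃ i, (V i).IsRegular δ) (hnonreg : ∃ i, ¬ (V i).IsRegular δ) :
    (∃ σ : Equiv.Perm (Fin t), QuiverRep.Rep.IsOrthogonalExceptionalSequence (fun i => V (σ i))) ∧
      ∀ i, (V i).dimVec ≠ δ := by
  open QuiverRep Rep in
  obtain ⟨hschur, horth⟩ := hV
  obtain ⟨k, hk⟩ := hnonreg
  have hself : ∀ i, eulerForm (V i).dimVec (V i).dimVec ≤ 1 := fun i => by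
    simpa [(hschur i).finrank_hom] using eulerForm_le_finrank_hom (V i) (V i)
  have hfin : ∀ i j, i ≠ j → Module.finrank K ((V i).Hom (V j)) = 0 := fun i j hij => by
    rw [horth i j hij, finrank_bot]
  have hle : ∀ i j, i ≠ j → eulerForm (V i).dimVec (V j).dimVec ≤ 0 := fun i j hij => by
    simpa [hfin i j hij] using eulerForm_le_finrank_hom (V i) (V j)
  have hpos : ∀ S : Finset (Fin t), S.Nonempty →
      ∃ i ∈ S, 0 < eulerForm (∑ j ∈ S, (V j).dimVec) (V i).dimVec := by
    intro S hS
    by_contra! hcon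
    refine hk ((hschur k).isRegular_of_defect_eq_zero ?_)
    exact heuclidean.isTitsNullRankOne.eulerForm_eq_zero (v := fun i => (V i).dimVec)
      (fun i x => Nat.cast_nonneg _) (fun i => (hschur i).dimVec_ne_zero) hle hS hcon hδ.2 k
  have hone : ∀ i, 0 < eulerForm (V i).dimVec (V i).dimVec := fun i => by
    obtain ⟨j, hj, h⟩ := hpos {i} (Finset.singleton_nonempty i)
    rw [Finset.mem_singleton] at hj
    subst hj
    simpa using h
  constructor
  · obtain ⟨σ, hσ⟩ := exists_perm_of_forall_exists_last
      (fun i j => eulerForm (V i).dimVec (V j).dimVec = 0) (fun S hS => by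
        obtain ⟨i, hi, h⟩ := hpos S hS
        refine ⟨i, hi, fun j hj hji => le_antisymm (hle j i hji) ?_⟩
        -- Isolate the terms of `i` (at most `1`) and `j`; the rest is nonpositive, so positivity of
        -- the total leaves `⟨vⱼ, vᵢ⟩ > -1`.
        rw [← eulerBilin_apply, map_sum, LinearMap.sum_apply, ← Finset.add_sum_erase S _ hi,
          ← Finset.add_sum_erase (S.erase i) _ (Finset.mem_erase.2 ⟨hji, hj⟩)] at h
        simp only [eulerBilin_apply] at h
        have h1 := hself i
        have h2 : ∑ x ∈ (S.erase i).erase j, eulerForm (V x).dimVec (V i).dimVec ≤ 0 :=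
          Finset.sum_nonpos fun x hx =>
            hle x i (Finset.mem_erase.1 (Finset.mem_erase.1 hx).2).1
        linarith)
    refine ⟨σ, ⟨fun i => ⟨hschur _, extOneVanishes_of_finrank_hom_le ?_⟩, fun i j hij =>
      ⟨horth _ _ (σ.injective.ne hij.ne), extOneVanishes_of_finrank_hom_le ?_⟩⟩,
      fun i j hij => horth _ _ (σ.injective.ne hij)⟩
    · rw [(hschur _).finrank_hom]
      exact hone (σ i)
    · rw [hfin _ _ (σ.injective.ne hij.ne), hσ i j hij]
      rfl
  · intro i hi
    have h1 := hone i
    rw [hi] at h1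
    exact absurd hδ.2 (not_le.2 h1)
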